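/- Let $D$ be a finite digraph without loops and with at most one arc between any two vertices. For a vertex $v$ put $N^+(v)=\{u: v\to u\}$ and $N^-(v)=\{u:u\to v\}$. A restriction vector is a vector $\mathbf r$ of non-negative integers indexed by $V(D)$, and $\mathrm{supp}(\mathbf r)=\{u:\mathbf r_u>0\}$. In the semi-restricted $D$-game with parameter $\mathbf r$, two players, Norman and Rei, play $\sum_u \mathbf r_u$ rounds, and Rei has to play each vertex $u$ exactly $\mathbf r_u$ times. In each round both players simultaneously and independently choose vertices, Norman $v$ and Rei $u$; Norman's score increases by $1$ if $u\in N^+(v)$, decreases by $1$ if $u\in N^-(v)$, and is unchanged otherwise; then $\mathbf r_u$ is decreased by $1$. A strategy for Norman assigns to each restriction vector $\mathbf r$ a probability distribution on $V(D)$, according to which he plays when Rei's remaining options are given by $\mathbf r$. A strategy for Rei assigns to each restriction vector $\mathbf r\neq 0$ a probability distribution on $V(D)$ whose support is contained in $\mathrm{supp}(\mathbf r)$. Let $\mathcal S_D(\mathbf r;\mathcal N,\mathcal R)$ be the expected final score of Norman under the strategies $\mathcal N,\mathcal R$, let $\mathcal S_D(\mathbf r;\mathcal R)=\max_{\mathcal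 N}\mathcal S_D(\mathbf r;\mathcal N,\mathcal R)$ and $\mathcal S_D(\mathbf r)=\min_{\mathcal R}\mathcal S_D(\mathbf r;\mathcal R)$. A strategy $\mathcal R$ for Rei is optimal if $\mathcal S_D(\mathbf r;\mathcal R)=\mathcal S_D(\mathbf r)$ for all $\mathbf r$, and it is oblivious if the distribution $\mathcal R(\mathbf r)$ depends only on $\mathrm{supp}(\mathbf r)$. The digraph $D$ is oblivious if Rei has an optimal strategy that is oblivious. Proposition. Let $D$ be a finite tournament, that is, a digraph as above in which any two distinct vertices are joined by an arc. Suppose that there is a non-empty set $S\subseteq V(D)$ with $|S|$ even such that $N^+(v)\cap S\not\subseteq N^+(w)\cap S$ for all $v\in S$ and all $w\in V(D)$ with $w\ne v$. Then $D$ is not oblivious. -/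

import Mathlib

noncomputable section

namespace SemiRestricted

variable {V : Type*}

/-- The digraphs considered here have no loops and at most one arc between two vertices
(the case `u = v` excludes loops). -/
def IsOriented (D : Digraph V) : Prop :=
  ∀ u v, D.Adj u v → ¬ D.Adj v u

/-- A tournament: exactly one arc between any two distinct vertices, and no loops. -/
def IsTournament (D : Digraph V) : Prop :=
  IsOriented D ∧ ∀ u v, u ≠ v → D.Adj u v ∨ D.Adj v u

/-- The out-neighbourhood `N⁺(v)`. -/
def outNbhd (D : Digraph V) (v : V) : Set V := {u | D.Adj v u}

/-- The in-neighbourhood `N⁻(v)`. -/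
def inNbhd (D : Digraph V) (v : V) : Set V := {u | D.Adj u v}

/-- A restriction vector `r`: Rei has to play the vertex `u` exactly `r u` times. -/
abbrev RestrictionVector (V : Type*) := V → ℕ

/-- A strategy for Norman: for each restriction vector, the law of the vertex he plays. -/
abbrev NormanStrategy (V : Type*) := RestrictionVector V → PMF V

/-- A strategy for Rei: for each restriction vector, the law of the vertex she plays, which is
carried by the options she still has. At `r = 0` the game is over and nothing is played, so the
value of `play` there is irrelevant. -/
structure ReiStrategy (V : Type*) where
  play : RestrictionVector V → PMF V
  support_subset : ∀ r, r ≠ 0 → (play r).support ⊆ Function.support r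

open Classical in
/-- Norman's gain in a single round of the `D`-game when he plays `v` and Rei plays `u`. -/
def gain (D : Digraph V) (v u : V) : ℤ :=
  if u ∈ outNbhd D v then 1 else if u ∈ inNbhd D v then -1 else 0

open Classical in
/-- The law of Norman's total score over the next `n` rounds, starting from the restriction
vector `r`. In each round both players choose simultaneously and independently, and then
the option that Rei played is used up once. -/
def scoreLawRounds (D : Digraph V) (N : NormanStrategy V) (R : ReiStrategy V) :
    ℕ → RestrictionVector V → PMF ℤ
  | 0, _ => PMF.pure 0
  | n + 1, r =>
    (N r).bind fun v => (R.play r).bind fun u =>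
      (scoreLawRounds D N R n (r - Pi.single u 1)).map fun s => gain D v u + s

/-- A strategy for Rei is oblivious if what she plays depends only on the support of `r`. -/
def ReiStrategy.IsOblivious (R : ReiStrategy V) : Prop :=
  ∀ r r' : RestrictionVector V, Function.support r = Function.support r' → R.play r = R.play r'

variable [Fintype V]

/-- The law of Norman's score in the semi-restricted `D`-game with parameter `r`,
which lasts `∑ u, r u` rounds. -/
def scoreLaw (D : Digraph V) (r : RestrictionVector V) (N : NormanStrategy V)
    (R : ReiStrategy V) : PMF ℤ :=
  scoreLawRounds D N R (∑ u, r u) r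

/-- Norman's expected score. -/
def expectedScore (D : Digraph V) (r : RestrictionVector V) (N : NormanStrategy V)
    (R : ReiStrategy V) : ℝ :=
  ∫ s, (s : ℝ) ∂(scoreLaw D r N R).toMeasure

/-- Norman's best expected score against the strategy `R` (all scores lie between
`-∑ u, r u` and `∑ u, r u`, and the supremum is a maximum, by compactness). -/
def scoreAgainst (D : Digraph V) (r : RestrictionVector V) (R : ReiStrategy V) : ℝ :=
  ⨆ N : NormanStrategy V, expectedScore D r N R

/-- Norman's expected score when both play optimally (the infimum is a minimum). -/
def optimalScore (D : Digraph V) (r : RestrictionVector V) : ℝ :=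
  ⨅ R : ReiStrategy V, scoreAgainst D r R

/-- `R` is an optimal strategy for Rei: it is optimal for every restriction vector. -/
def IsOptimal (D : Digraph V) (R : ReiStrategy V) : Prop :=
  ∀ r, scoreAgainst D r R = optimalScore D r

/-- `D` is oblivious: Rei has an optimal strategy in the semi-restricted `D`-game which is
oblivious. -/
def IsObliviousDigraph (D : Digraph V) : Prop :=
  ∃ R : ReiStrategy V, IsOptimal D R ∧ R.IsOblivious

end SemiRestricted

end

noncomputable section

namespace SemiRestricted

open MeasureTheory Filter Topology

/-! ### The payoff of one round, and its reduction modulo two. -/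

section Gain

variable {V : Type*} (D : Digraph V)

/-! Norman's move never affects Rei's remaining options, so he does best by responding myopically to
her law in each round. Suppose `R` is optimal and oblivious, and let `q` be its law on the support
`S`.

Every `v ∈ S` is then a best response to `q` (`IsOptimal.expectedGain_eq_bestGain`). Let `T` be the
set of vertices of `S` beaten by `v`, and give Rei `n` copies of each vertex of `T` and one of each
other vertex of `S`. By always playing `v`, Norman keeps the deficit (rounds minus score) bounded in
`n`. If `v` were not a best response, shifting `q` slightly towards the uniform law on `T` would
face only best responses that miss a vertex of `T`, and optimality would make the deficit grow by at
least `1/|T|` each time `n` increases.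

So all vertices of `S` have the same expected gain against `q`. It is zero by skew-symmetry, hence
`q` restricted to `S` lies in the kernel of the skew matrix of `S`. Modulo two this matrix is all
ones off the diagonal, which is nonsingular in even order. Thus `q = 0`, which is absurd. -/

theorem gain_le_one (v u : V) : gain D v u ≤ 1 := by
  unfold gain; split_ifs <;> simp

theorem neg_one_le_gain (v u : V) : -1 ≤ gain D v u := by
  unfold gain; split_ifs <;> simp

theorem gain_nonpos {v u : V} (h : ¬ D.Adj v u) : gain D v u ≤ 0 := by
  unfold gain
  rw [if_neg (show u ∉ outNbhd D v from h)]
  split_ifs <;> simp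

theorem gain_of_adj {v u : V} (h : D.Adj v u) : gain D v u = 1 :=
  if_pos h

variable {D}

theorem gain_swap (hD : IsOriented D) (v u : V) : gain D u v = -gain D v u := by
  have h1 := hD u v
  have h2 := hD v u
  by_cases huv : D.Adj u v <;> by_cases hvu : D.Adj v u <;>
    simp_all [gain, outNbhd, inNbhd]

theorem gain_cast_zmod_two [DecidableEq V] (hD : IsTournament D) (v u : V) :
    (gain D v u : ZMod 2) = if v = u then 0 else 1 := by
  have hneg : (-1 : ZMod 2) = 1 := by decide
  have h1 := hD.1 u v
  have h2 := hD.2 u v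
  by_cases e : v = u
  · subst e
    simp_all [gain, outNbhd, inNbhd]
  · by_cases huv : D.Adj u v <;> by_cases hvu : D.Adj v u <;>
      simp_all [gain, outNbhd, inNbhd, eq_comm]

end Gain

/-! ### Nonsingularity of the skew matrix of an even tournament. -/

section Determinant

/-- The matrix with zero diagonal and all other entries one, of even size, is an involution
modulo two. -/
theorem compl_one_mul_self {ι : Type*} [Fintype ι] [DecidableEq ι] (hι : Even (Fintype.card ι)) :
    (Matrix.of fun i j : ι => if i = j then (0 : ZMod 2) else 1) *
      (Matrix.of fun i j : ι => if i = j then (0 : ZMod 2) else 1) = 1 := by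
  have h2 : (2 : ZMod 2) = 0 := by decide
  have hsplit : (Matrix.of fun i j : ι => if i = j then (0 : ZMod 2) else 1) =
      Matrix.of (fun _ _ => 1) - 1 := by
    ext i j
    by_cases e : i = j <;> simp [e]
  -- The all-ones matrix `J` satisfies `J² = |ι| J`, which vanishes since `|ι|` is even; hence `(J -
  -- 1)² = 1` modulo two.
  have hJ : (Matrix.of fun _ _ : ι => (1 : ZMod 2)) * (Matrix.of fun _ _ : ι => (1 : ZMod 2)) =
      0 := by
    ext i j
    simpa [Matrix.mul_apply] using (ZMod.natCast_eq_zero_iff_even).2 hι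
  rw [hsplit, sub_mul, mul_sub, hJ]
  ext i j
  simp

/-- The skew matrix of a tournament of even order is nonsingular. -/
theorem det_gain_ne_zero {V : Type*} {D : Digraph V} (hD : IsTournament D) (S : Finset V)
    [DecidableEq V] (hS : Even S.card) :
    (Matrix.of fun i j : S => (gain D i j : ℝ)).det ≠ 0 := by
  have hZ : (Matrix.of fun i j : S => gain D i j).det ≠ 0 := by
    intro h0
    have h1 := congrArg (Int.castRingHom (ZMod 2)) h0
    rw [RingHom.map_det, map_zero] at h1
    have h2 : (Int.castRingHom (ZMod 2)).mapMatrix (Matrix.of fun i j : S => gain D i j) =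
        Matrix.of fun i j : S => if i = j then (0 : ZMod 2) else 1 := by
      ext i j
      simp [gain_cast_zmod_two hD]
    have h3 := congrArg Matrix.det (compl_one_mul_self (ι := S) (by simpa using hS))
    rw [Matrix.det_mul, ← h2, h1] at h3
    simp at h3
  have h4 := RingHom.map_det (Int.castRingHom ℝ) (Matrix.of fun i j : S => gain D i j)
  have h5 : (Int.castRingHom ℝ).mapMatrix (Matrix.of fun i j : S => gain D i j) =
      Matrix.of fun i j : S => (gain D i j : ℝ) := by
    ext i j
    simp
  rw [h5] at h4
  rw [← h4]
  simpa using hZ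

end Determinant

/-! ### Laws as real weights, and expectations of bound laws. -/

section Weight

variable {V : Type*}

/-- The probabilities of a law, as real numbers. -/
def weight (p : PMF V) (u : V) : ℝ := (p u).toReal

theorem weight_nonneg (p : PMF V) (u : V) : 0 ≤ weight p u := ENNReal.toReal_nonneg

theorem weight_eq_zero {p : PMF V} {u : V} (h : u ∉ p.support) : weight p u = 0 := by
  simp [weight, (PMF.apply_eq_zero_iff p u).2 h]

variable [Fintype V]

theorem sum_weight (p : PMF V) : ∑ u, weight p u = 1 := by
  have h := p.tsum_coe
  rw [tsum_fintype] at h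
  unfold weight
  rw [← ENNReal.toReal_sum (fun u _ => p.apply_ne_top u), h, ENNReal.toReal_one]

theorem exists_pmf_weight_eq (x : V → ℝ) (h0 : ∀ u, 0 ≤ x u) (h1 : ∑ u, x u = 1) :
    ∃ p : PMF V, weight p = x := by
  refine ⟨PMF.ofFintype (fun u => ENNReal.ofReal (x u)) ?_, ?_⟩
  · rw [← ENNReal.ofReal_sum_of_nonneg (fun u _ => h0 u), h1, ENNReal.ofReal_one]
  · funext u
    simp [weight, h0 u]

theorem toMeasure_bind_eq_sum {α : Type*} [MeasurableSpace α] (p : PMF V) (κ : V → PMF α) :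
    (p.bind κ).toMeasure = ∑ v, p v • (κ v).toMeasure := by
  ext s hs
  rw [PMF.toMeasure_bind_apply _ _ _ hs, tsum_fintype]
  simp

theorem integrable_toMeasure_bind (p : PMF V) (κ : V → PMF ℤ)
    (h : ∀ v, Integrable (fun s : ℤ => (s : ℝ)) (κ v).toMeasure) :
    Integrable (fun s : ℤ => (s : ℝ)) (p.bind κ).toMeasure := by
  rw [toMeasure_bind_eq_sum]
  exact integrable_finsetSum_measure.2 fun v _ => (h v).smul_measure (p.apply_ne_top v)

theorem integral_toMeasure_bind (p : PMF V) (κ : V → PMF ℤ)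
    (h : ∀ v, Integrable (fun s : ℤ => (s : ℝ)) (κ v).toMeasure) :
    ∫ s, (s : ℝ) ∂(p.bind κ).toMeasure =
      ∑ v, weight p v * ∫ s, (s : ℝ) ∂(κ v).toMeasure := by
  rw [toMeasure_bind_eq_sum,
    integral_finsetSum_measure fun v _ => (h v).smul_measure (p.apply_ne_top v)]
  simp [integral_smul_measure, weight]

theorem integrable_toMeasure_map_add (p : PMF ℤ) (a : ℤ)
    (h : Integrable (fun s : ℤ => (s : ℝ)) p.toMeasure) :
    Integrable (fun s : ℤ => (s : ℝ)) (p.map fun s => a + s).toMeasure := by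
  rw [← PMF.toMeasure_map p (f := fun s : ℤ => a + s) (measurable_of_countable _),
    integrable_map_measure (measurable_of_countable _).aestronglyMeasurable
      (measurable_of_countable _).aemeasurable]
  simpa [Function.comp_def] using (integrable_const (a : ℝ)).add h

theorem integral_toMeasure_map_add (p : PMF ℤ) (a : ℤ)
    (h : Integrable (fun s : ℤ => (s : ℝ)) p.toMeasure) :
    ∫ s, (s : ℝ) ∂(p.map fun s => a + s).toMeasure = a + ∫ s, (s : ℝ) ∂p.toMeasure := by
  rw [← PMF.toMeasure_map p (f := fun s : ℤ => a + s) (measurable_of_countable _),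
    integral_map (measurable_of_countable _).aemeasurable
      (measurable_of_countable _).aestronglyMeasurable]
  simp only [Int.cast_add]
  rw [integral_add (integrable_const _) h]
  simp

end Weight

/-! ### Best responses in a single round. -/

section BestGain

variable {V : Type*} [Fintype V] (D : Digraph V)

/-- Norman's expected gain in one round when he plays `w` and Rei plays according to `q`. -/
def expectedGain (q : V → ℝ) (w : V) : ℝ := ∑ u, q u * (gain D w u : ℝ)

/-- Norman's best expected gain in one round when Rei plays according to `q`. -/
def bestGain (q : V → ℝ) : ℝ := ⨆ w, expectedGain D q w

theorem expectedGain_le_bestGain (q : V → ℝ) (w : V) : expectedGain D q w ≤ bestGain D q :=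
  le_ciSup (Set.finite_range _).bddAbove w

theorem exists_expectedGain_eq_bestGain [Nonempty V] (q : V → ℝ) :
    ∃ w, expectedGain D q w = bestGain D q :=
  exists_eq_ciSup_of_finite

theorem expectedGain_mix (q t : V → ℝ) (ε : ℝ) (w : V) :
    expectedGain D (fun u => (1 - ε) * q u + ε * t u) w =
      (1 - ε) * expectedGain D q w + ε * expectedGain D t w := by
  simp only [expectedGain, Finset.mul_sum, ← Finset.sum_add_distrib]
  exact Finset.sum_congr rfl fun u _ => by ring

theorem expectedGain_le_one {q : V → ℝ} (h0 : ∀ u, 0 ≤ q u) (h1 : ∑ u, q u = 1) (w : V) :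
    expectedGain D q w ≤ 1 := by
  rw [← h1]
  refine Finset.sum_le_sum fun u _ => mul_le_of_le_one_right (h0 u) ?_
  exact_mod_cast gain_le_one D w u

/-- A first-order bound for Norman's best gain: it only involves his best responses. -/
theorem exists_bestGain_mix_le [Nonempty V] (q t : V → ℝ) (c : ℝ)
    (h : ∀ w, expectedGain D q w = bestGain D q → expectedGain D t w ≤ c) :
    ∃ ε : ℝ, 0 < ε ∧ ε ≤ 1 ∧
      bestGain D (fun u => (1 - ε) * q u + ε * t u) ≤ (1 - ε) * bestGain D q + ε * c := by
  have key : ∀ w, ∀ᶠ ε : ℝ in 𝓝[>] 0, expectedGain D (fun u => (1 - ε) * q u + ε * t u) w ≤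
      (1 - ε) * bestGain D q + ε * c := by
    intro w
    simp only [expectedGain_mix]
    rcases (expectedGain_le_bestGain D q w).eq_or_lt with e | hlt
    · filter_upwards [self_mem_nhdsWithin] with ε hε
      rw [e]
      have := mul_le_mul_of_nonneg_left (h w e) (le_of_lt (show (0 : ℝ) < ε from hε))
      linarith
    -- A vertex that is not a best response has strict slack at `ε = 0`, which persists for small
    -- `ε` by continuity.
    · have hl : Tendsto (fun ε : ℝ => (1 - ε) * expectedGain D q w + ε * expectedGain D t w)
          (𝓝 0) (𝓝 (expectedGain D q w)) := by
        have : Continuous fun ε : ℝ =>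
          (1 - ε) * expectedGain D q w + ε * expectedGain D t w := by fun_prop
        simpa using this.tendsto 0
      have hr : Tendsto (fun ε : ℝ => (1 - ε) * bestGain D q + ε * c)
          (𝓝 0) (𝓝 (bestGain D q)) := by
        have : Continuous fun ε : ℝ => (1 - ε) * bestGain D q + ε * c := by fun_prop
        simpa using this.tendsto 0
      exact ((hl.eventually_lt hr hlt).mono fun _ hx => hx.le).filter_mono nhdsWithin_le_nhds
  have hle : ∀ᶠ ε : ℝ in 𝓝[>] 0, ε ≤ 1 :=
    (eventually_le_nhds one_pos).filter_mono nhdsWithin_le_nhds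
  have hpos : ∀ᶠ ε : ℝ in 𝓝[>] 0, 0 < ε := self_mem_nhdsWithin
  obtain ⟨ε, h1, h2, h3⟩ := ((eventually_all.2 key).and (hle.and hpos)).exists
  exact ⟨ε, h3, h2, ciSup_le h1⟩

end BestGain

/-! ### Backward induction for Norman's best score. -/

section Value

open Classical in
theorem sub_single_add_single {V : Type*} {r : RestrictionVector V} {u : V} (hu : r u ≠ 0) :
    r - Pi.single u 1 + Pi.single u 1 = r := by
  funext x
  by_cases e : x = u
  · subst e
    simp only [Pi.add_apply, Pi.sub_apply, Pi.single_eq_same]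
    omega
  · simp [e]

variable {V : Type*} [Fintype V] (D : Digraph V)

open Classical in
/-- Norman's best expected score against `R` over `n` rounds, computed by backward induction. -/
def value (R : ReiStrategy V) : ℕ → RestrictionVector V → ℝ
  | 0, _ => 0
  | n + 1, r => ∑ u, weight (R.play r) u * value R n (r - Pi.single u 1) +
      bestGain D (weight (R.play r))

open Classical in
theorem integrable_scoreLawRounds (N : NormanStrategy V) (R : ReiStrategy V) (n : ℕ)
    (r : RestrictionVector V) :
    Integrable (fun s : ℤ => (s : ℝ)) (scoreLawRounds D N R n r).toMeasure := by
  induction n generalizing r with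
  | zero => simp [scoreLawRounds, PMF.toMeasure_pure, integrable_dirac]
  | succ n ih =>
    exact integrable_toMeasure_bind _ _ fun v => integrable_toMeasure_bind _ _ fun u =>
      integrable_toMeasure_map_add _ _ (ih _)

open Classical in
-- The continuation depends on Rei's move alone, so the gain of the current round separates from it.
theorem integral_scoreLawRounds_succ (N : NormanStrategy V) (R : ReiStrategy V) (n : ℕ)
    (r : RestrictionVector V) :
    ∫ s, (s : ℝ) ∂(scoreLawRounds D N R (n + 1) r).toMeasure =
      ∑ u, weight (R.play r) u *
          ∫ s, (s : ℝ) ∂(scoreLawRounds D N R n (r - Pi.single u 1)).toMeasure +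
        ∑ v, weight (N r) v * expectedGain D (weight (R.play r)) v := by
  have hI := integrable_scoreLawRounds D N R n
  have h1 : ∀ v, ∫ s, (s : ℝ) ∂((R.play r).bind fun u =>
        (scoreLawRounds D N R n (r - Pi.single u 1)).map fun s => gain D v u + s).toMeasure =
      ∑ u, weight (R.play r) u *
          ∫ s, (s : ℝ) ∂(scoreLawRounds D N R n (r - Pi.single u 1)).toMeasure +
        expectedGain D (weight (R.play r)) v := by
    intro v
    rw [integral_toMeasure_bind _ _ fun u => integrable_toMeasure_map_add _ _ (hI _), expectedGain,
      ← Finset.sum_add_distrib]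
    refine Finset.sum_congr rfl fun u _ => ?_
    rw [integral_toMeasure_map_add _ _ (hI _)]
    ring
  rw [scoreLawRounds, integral_toMeasure_bind _ _ fun v => integrable_toMeasure_bind _ _ fun u =>
    integrable_toMeasure_map_add _ _ (hI _)]
  simp only [h1, mul_add, Finset.sum_add_distrib, ← Finset.sum_mul, sum_weight, one_mul]

theorem integral_scoreLawRounds_le_value (N : NormanStrategy V) (R : ReiStrategy V) (n : ℕ)
    (r : RestrictionVector V) :
    ∫ s, (s : ℝ) ∂(scoreLawRounds D N R n r).toMeasure ≤ value D R n r := by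
  induction n generalizing r with
  | zero => simp [scoreLawRounds, value, PMF.toMeasure_pure]
  | succ n ih =>
    rw [integral_scoreLawRounds_succ, value]
    refine add_le_add (Finset.sum_le_sum fun u _ =>
      mul_le_mul_of_nonneg_left (ih _) (weight_nonneg _ _)) ?_
    calc _ ≤ ∑ v, weight (N r) v * bestGain D (weight (R.play r)) :=
          Finset.sum_le_sum fun v _ => mul_le_mul_of_nonneg_left
            (expectedGain_le_bestGain D _ v) (weight_nonneg _ _)
      _ = _ := by rw [← Finset.sum_mul, sum_weight, one_mul]

/-- Norman can attain the value by playing, in each round, a best response for that round. -/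
theorem exists_integral_scoreLawRounds_eq_value [Nonempty V] (R : ReiStrategy V) :
    ∃ N : NormanStrategy V, ∀ n r,
      ∫ s, (s : ℝ) ∂(scoreLawRounds D N R n r).toMeasure = value D R n r := by
  classical
  choose b hb using fun r => exists_expectedGain_eq_bestGain D (weight (R.play r))
  refine ⟨fun r => PMF.pure (b r), fun n => ?_⟩
  induction n with
  | zero => intro r; simp [scoreLawRounds, value, PMF.toMeasure_pure]
  | succ n ih =>
    intro r
    rw [integral_scoreLawRounds_succ, value, ← hb r]
    simp only [ih]
    congr 1
    rw [Finset.sum_eq_single (b r)]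
    · simp [weight]
    · intro v _ hv
      simp [weight, PMF.pure_apply, hv]
    · simp

theorem scoreAgainst_eq_value [Nonempty V] (r : RestrictionVector V) (R : ReiStrategy V) :
    scoreAgainst D r R = value D R (∑ u, r u) r := by
  obtain ⟨N, hN⟩ := exists_integral_scoreLawRounds_eq_value D R
  have : IsGreatest (Set.range fun N => expectedScore D r N R) (value D R (∑ u, r u) r) :=
    ⟨⟨N, hN _ _⟩, by rintro _ ⟨N', rfl⟩; exact integral_scoreLawRounds_le_value D N' R _ _⟩
  exact this.csSup_eq

open Classical in
theorem sum_sub_single {r : RestrictionVector V} {u : V} (hu : r u ≠ 0) :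
    ∑ x, (r - Pi.single u 1 : V → ℕ) x + 1 = ∑ x, r x := by
  conv_rhs => rw [← sub_single_add_single hu]
  simp [Finset.sum_add_distrib, -Pi.sub_apply]

/-- Norman can always play the same vertex. -/
theorem sum_gain_le_value (R : ReiStrategy V) (v : V) (n : ℕ) (r : RestrictionVector V)
    (hr : ∑ u, r u = n) : ∑ u, (r u : ℝ) * gain D v u ≤ value D R n r := by
  classical
  induction n generalizing r with
  | zero => simp_all [value]
  | succ n ih =>
    rw [value]
    have hr0 : r ≠ 0 := by rintro rfl; simp at hr
    calc ∑ u, (r u : ℝ) * gain D v u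
        = ∑ x, weight (R.play r) x * ∑ u, (r u : ℝ) * gain D v u := by
          rw [← Finset.sum_mul, sum_weight, one_mul]
      _ ≤ ∑ x, weight (R.play r) x * (value D R n (r - Pi.single x 1) + gain D v x) := by
          refine Finset.sum_le_sum fun x _ => ?_
          by_cases hx : r x = 0
          · rw [weight_eq_zero fun hs => R.support_subset r hr0 hs hx]
            simp
          · refine mul_le_mul_of_nonneg_left ?_ (weight_nonneg _ _)
            have h1 := ih (r - Pi.single x 1) (by have := sum_sub_single hx; omega)
            have h2 : ∑ u, (r u : ℝ) * gain D v u =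
                ∑ u, ((r - Pi.single x 1 : V → ℕ) u : ℝ) * gain D v u + gain D v x := by
              conv_lhs => rw [← sub_single_add_single hx]
              simp [add_mul, Finset.sum_add_distrib, -Pi.sub_apply, Pi.single_apply]
            linarith
      _ = ∑ x, weight (R.play r) x * value D R n (r - Pi.single x 1) +
            expectedGain D (weight (R.play r)) v := by
          simp only [expectedGain, mul_add, Finset.sum_add_distrib]
      _ ≤ _ := by
          gcongr
          exact expectedGain_le_bestGain D _ v

theorem value_congr (R R' : ReiStrategy V) (m : ℕ)
    (h : ∀ r : RestrictionVector V, ∑ u, r u < m → R.play r = R'.play r)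
    (n : ℕ) (r : RestrictionVector V) (hr : ∑ u, r u < m) : value D R n r = value D R' n r := by
  classical
  induction n generalizing r with
  | zero => rfl
  | succ n ih =>
    rw [value, value, h r hr]
    congr 1
    refine Finset.sum_congr rfl fun u _ => ?_
    rw [ih]
    exact (Finset.sum_le_sum fun x _ => Nat.sub_le _ _).trans_lt hr

end Value

/-! ### Optimal strategies: one-round deviations, the deficit, best responses. -/

section Optimal

variable {V : Type*} [Fintype V] {D : Digraph V}

open Classical in
theorem scoreAgainst_eq_sum [Nonempty V] (R : ReiStrategy V) {r : RestrictionVector V}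
    (hr : r ≠ 0) :
    scoreAgainst D r R = ∑ u, weight (R.play r) u * scoreAgainst D (r - Pi.single u 1) R +
      bestGain D (weight (R.play r)) := by
  simp only [scoreAgainst_eq_value]
  obtain ⟨y, hy⟩ := Function.ne_iff.1 hr
  rw [← sum_sub_single hy, value]
  congr 1
  refine Finset.sum_congr rfl fun u _ => ?_
  -- For `r u = 0` truncated subtraction leaves `r` unchanged and the round count would be off, but
  -- such `u` has weight zero.
  by_cases hu : r u = 0
  · rw [weight_eq_zero fun hs => R.support_subset r hr hs hu]
    simp
  · have h1 := sum_sub_single hy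
    have h2 := sum_sub_single hu
    rw [show ∑ x, (r - Pi.single y 1 : V → ℕ) x = ∑ x, (r - Pi.single u 1 : V → ℕ) x by omega]

open Classical in
/-- Against an optimal strategy, Rei cannot gain by changing the law of a single round. -/
theorem IsOptimal.le_sum [Nonempty V] {R : ReiStrategy V} (hR : IsOptimal D R)
    {r : RestrictionVector V} {t : V → ℝ} (h0 : ∀ u, 0 ≤ t u) (h1 : ∑ u, t u = 1)
    (ht : ∀ u, t u ≠ 0 → r u ≠ 0) :
    scoreAgainst D r R ≤ ∑ u, t u * scoreAgainst D (r - Pi.single u 1) R + bestGain D t := by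
  obtain ⟨p, rfl⟩ := exists_pmf_weight_eq t h0 h1
  have hr : r ≠ 0 := by
    rintro rfl
    have : ∀ u, weight p u = 0 := fun u => by_contra fun h => ht u h rfl
    simp [this] at h1
  -- Deviate at `r` only; all later positions have fewer rounds left, so their values are those of
  -- `R`.
  let R' : ReiStrategy V :=
    { play := Function.update R.play r p
      support_subset := by
        intro s hs
        by_cases e : s = r
        · subst e
          rw [Function.update_self]
          intro u hu
          refine ht u ?_
          rw [weight, ENNReal.toReal_ne_zero]
          exact ⟨(PMF.mem_support_iff p u).1 hu, p.apply_ne_top u⟩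
        · rw [Function.update_of_ne e]
          exact R.support_subset s hs }
  have hplay : R'.play r = p := Function.update_self ..
  have hle : scoreAgainst D r R ≤ scoreAgainst D r R' := by
    rw [hR r]
    refine ciInf_le ⟨∑ u, (r u : ℝ) * gain D (Classical.arbitrary V) u, ?_⟩ R'
    rintro _ ⟨Q, rfl⟩
    simp only [scoreAgainst_eq_value]
    exact sum_gain_le_value D Q _ _ r rfl
  refine hle.trans_eq ?_
  rw [scoreAgainst_eq_sum R' hr, hplay]
  congr 1
  refine Finset.sum_congr rfl fun u _ => ?_
  by_cases hu : weight p u = 0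
  · simp [hu]
  · congr 1
    simp only [scoreAgainst_eq_value]
    refine value_congr D R' R (∑ u, r u) (fun s hs => ?_) _ _ ?_
    · exact Function.update_of_ne (by rintro rfl; exact lt_irrefl _ hs) _ _
    · have := sum_sub_single (ht u hu)
      omega

/-- The amount by which Norman's score falls short of the number of rounds. -/
def deficit (D : Digraph V) (R : ReiStrategy V) (r : RestrictionVector V) : ℝ :=
  ∑ u, (r u : ℝ) - scoreAgainst D r R

open Classical in
-- Rei may play `u` at once, which costs her at most one point.
theorem IsOptimal.deficit_sub_single_le [Nonempty V] {R : ReiStrategy V} (hR : IsOptimal D R)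
    {r : RestrictionVector V} {u : V} (hu : r u ≠ 0) :
    deficit D R (r - Pi.single u 1) ≤ deficit D R r := by
  have h0 : ∀ x, 0 ≤ (Pi.single u (1 : ℝ) : V → ℝ) x := fun x => by
    by_cases e : x = u <;> simp [e]
  have h1 : ∑ x, (Pi.single u (1 : ℝ) : V → ℝ) x = 1 := by simp
  have key := hR.le_sum (r := r) h0 h1 (fun x hx => by
    by_cases e : x = u
    · rwa [e]
    · simp [e] at hx)
  have hb : bestGain D (Pi.single u (1 : ℝ) : V → ℝ) ≤ 1 :=
    ciSup_le fun w => expectedGain_le_one D h0 h1 w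
  have hs : (∑ x, ((r - Pi.single u 1 : V → ℕ) x : ℝ)) + 1 = ∑ x, (r x : ℝ) := by
    exact_mod_cast sum_sub_single hu
  simp only [Pi.single_apply, ite_mul, one_mul, zero_mul, Finset.sum_ite_eq', Finset.mem_univ,
    if_true] at key
  unfold deficit
  linarith

theorem IsOptimal.deficit_mono [Nonempty V] {R : ReiStrategy V} (hR : IsOptimal D R) :
    Monotone (deficit D R) := by
  classical
  intro r s hrs
  obtain ⟨d, rfl⟩ := exists_add_of_le hrs
  clear hrs
  induction hn : ∑ u, d u generalizing d with
  | zero =>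
    have : d = 0 := by funext u; simp_all
    simp [this]
  | succ n ih =>
    have hd : d ≠ 0 := by rintro rfl; simp at hn
    obtain ⟨u, hu⟩ := Function.ne_iff.1 hd
    have h1 := ih (d - Pi.single u 1) (by have := sum_sub_single hu; omega)
    have h2 := hR.deficit_sub_single_le (r := r + d) (u := u) (by
      have : d u ≠ 0 := hu
      simp only [Pi.add_apply]
      omega)
    have h3 : r + d - Pi.single u 1 = r + (d - Pi.single u 1) := by
      conv_lhs => rw [← sub_single_add_single hu, ← add_assoc]
      exact add_tsub_cancel_right _ _
    rw [h3] at h2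
    exact h1.trans h2

open Classical in
/-- Moving the law of a single round of an optimal strategy in a direction along which all of
Norman's best responses gain at most `c`. -/
theorem IsOptimal.le_sum_add_of_bestResponse [Nonempty V] {R : ReiStrategy V}
    (hR : IsOptimal D R) {r : RestrictionVector V} {t : V → ℝ} {c : ℝ} (h0 : ∀ u, 0 ≤ t u)
    (h1 : ∑ u, t u = 1) (ht : ∀ u, t u ≠ 0 → r u ≠ 0)
    (hc : ∀ w, expectedGain D (weight (R.play r)) w = bestGain D (weight (R.play r)) →
      expectedGain D t w ≤ c) :
    scoreAgainst D r R ≤ ∑ u, t u * scoreAgainst D (r - Pi.single u 1) R + c := by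
  obtain ⟨ε, hε, hε1, hmix⟩ := exists_bestGain_mix_le D _ t c hc
  have hr : r ≠ 0 := by
    rintro rfl
    have : ∀ u, t u = 0 := fun u => by_contra fun h => ht u h rfl
    simp [this] at h1
  have hq := scoreAgainst_eq_sum (D := D) R hr
  set q := weight (R.play r) with hqdef
  have key := hR.le_sum (r := r) (t := fun u => (1 - ε) * q u + ε * t u)
    (fun u => add_nonneg (mul_nonneg (by linarith) (weight_nonneg _ _))
      (mul_nonneg hε.le (h0 u)))
    (by rw [Finset.sum_add_distrib, ← Finset.mul_sum, ← Finset.mul_sum, h1, hqdef, sum_weight]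
        ring)
    (fun u hu hru => hu (by
      have h2 : q u = 0 := weight_eq_zero fun hs => R.support_subset r hr hs hru
      have h3 : t u = 0 := by_contra fun h => ht u h hru
      simp [h2, h3]))
  have hsplit : ∑ u, ((1 - ε) * q u + ε * t u) * scoreAgainst D (r - Pi.single u 1) R =
      (1 - ε) * ∑ u, q u * scoreAgainst D (r - Pi.single u 1) R +
        ε * ∑ u, t u * scoreAgainst D (r - Pi.single u 1) R := by
    simp only [Finset.mul_sum, ← Finset.sum_add_distrib]
    exact Finset.sum_congr rfl fun u _ => by ring
  rw [hsplit] at key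
  -- Subtracting `1 - ε` times the equation for `q` leaves `ε` times the claim.
  refine le_of_mul_le_mul_left ?_ hε
  have hq' := congrArg (fun x => (1 - ε) * x) hq
  simp only [mul_add] at hq'
  linarith

open Classical in
/-- If no other vertex beats all the vertices of `S` beaten by `v`, then `v` is among Norman's
best responses to an oblivious optimal strategy as long as Rei's options are those in `S`. -/
theorem IsOptimal.expectedGain_eq_bestGain [Nonempty V] {R : ReiStrategy V}
    (hR : IsOptimal D R) (hO : R.IsOblivious) {S : Finset V} {v : V}
    (hT : ∃ u ∈ S, D.Adj v u)
    (h : ∀ w, w ≠ v → ∃ u ∈ S, D.Adj v u ∧ ¬ D.Adj w u)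
    {r : RestrictionVector V} (hr : Function.support r = S) :
    expectedGain D (weight (R.play r)) v = bestGain D (weight (R.play r)) := by
  by_contra hne
  set T := S.filter fun u => D.Adj v u with hTdef
  obtain ⟨u₀, hu₀S, hu₀⟩ := hT
  have hTcard : (0 : ℝ) < T.card := by
    exact_mod_cast Finset.card_pos.2 ⟨u₀, Finset.mem_filter.2 ⟨hu₀S, hu₀⟩⟩
  let a : ℕ → RestrictionVector V := fun n u => if u ∈ T then n else if u ∈ S then 1 else 0
  let t : V → ℝ := fun u => if u ∈ T then (T.card : ℝ)⁻¹ else 0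
  have hsum : ∀ F : V → ℝ, ∑ u, t u * F u = (T.card : ℝ)⁻¹ * ∑ u ∈ T, F u := by
    intro F
    simp [t, ite_mul, Finset.sum_ite_mem, Finset.mul_sum]
  have ht0 : ∀ u, 0 ≤ t u := fun u => by
    simp only [t]; split_ifs <;> positivity
  have ht1 : ∑ u, t u = 1 := by
    have := hsum fun _ => 1
    simp only [mul_one, Finset.sum_const, nsmul_eq_mul] at this
    rw [this, inv_mul_cancel₀ hTcard.ne']
  have hsupp : ∀ n, Function.support (a (n + 1)) = S := by
    intro n
    ext u
    by_cases h1 : u ∈ S <;> by_cases h2 : D.Adj v u <;> simp [a, hTdef, h1, h2]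
  have htw : ∀ w, w ≠ v → expectedGain D t w ≤ 1 - (T.card : ℝ)⁻¹ := by
    intro w hw
    obtain ⟨y, hyS, hvy, hwy⟩ := h w hw
    have hyT : y ∈ T := Finset.mem_filter.2 ⟨hyS, hvy⟩
    have hle : ∑ u ∈ T, (gain D w u : ℝ) ≤ T.card - 1 := by
      rw [← Finset.add_sum_erase T _ hyT]
      have h1 : (gain D w y : ℝ) ≤ 0 := by exact_mod_cast gain_nonpos D hwy
      have h2 : ∑ u ∈ T.erase y, (gain D w u : ℝ) ≤ ∑ u ∈ T.erase y, 1 :=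
        Finset.sum_le_sum fun u _ => by exact_mod_cast gain_le_one D w u
      have h3 : ((T.erase y).card : ℝ) + 1 = T.card := by
        exact_mod_cast Finset.card_erase_add_one hyT
      simp only [Finset.sum_const, nsmul_eq_mul, mul_one] at h2
      linarith
    rw [expectedGain, hsum]
    calc _ ≤ (T.card : ℝ)⁻¹ * (T.card - 1) := by gcongr
      _ = _ := by rw [mul_sub, inv_mul_cancel₀ hTcard.ne', mul_one]
  have hstep : ∀ n, deficit D R (a n) + (T.card : ℝ)⁻¹ ≤ deficit D R (a (n + 1)) := by
    intro n
    have hplay : R.play (a (n + 1)) = R.play r := hO _ _ ((hsupp n).trans hr.symm)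
    have haT : ∀ u ∈ T, a (n + 1) u ≠ 0 := fun u hu => by simp [a, hu]
    have key := hR.le_sum_add_of_bestResponse (r := a (n + 1)) (t := t)
      (c := 1 - (T.card : ℝ)⁻¹) ht0 ht1
      (fun u hu => haT u (by by_contra hn; simp [t, hn] at hu))
      (fun w hw => htw w (by rintro rfl; rw [hplay] at hw; exact hne hw))
    have hle : ∑ u, t u * scoreAgainst D (a (n + 1) - Pi.single u 1) R ≤
        ∑ u, t u * (∑ x, (a (n + 1) x : ℝ) - 1 - deficit D R (a n)) := by
      refine Finset.sum_le_sum fun u _ => ?_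
      by_cases hu : u ∈ T
      · refine mul_le_mul_of_nonneg_left ?_ (ht0 u)
        -- Removing one copy of `u ∈ T` from `a (n + 1)` leaves a vector above `a n`.
        have hmono : deficit D R (a n) ≤ deficit D R (a (n + 1) - Pi.single u 1) := by
          refine hR.deficit_mono fun x => ?_
          by_cases e : x = u
          · subst e
            simp [a, hu]
          · by_cases hx : x ∈ T <;> simp [a, e, hx]
        have hs : (∑ x, ((a (n + 1) - Pi.single u 1 : V → ℕ) x : ℝ)) + 1 = ∑ x, (a (n + 1) x : ℝ) := by
          exact_mod_cast sum_sub_single (haT u hu)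
        rw [deficit] at hmono ⊢
        rw [deficit] at hmono
        linarith
      · simp [t, hu]
    rw [← Finset.sum_mul, ht1, one_mul] at hle
    rw [deficit] at hle ⊢
    rw [deficit]
    linarith
  have hlow : ∀ n : ℕ, deficit D R (a 0) + n * (T.card : ℝ)⁻¹ ≤ deficit D R (a n) := by
    intro n
    induction n with
    | zero => simp
    | succ n ih =>
      have := hstep n
      push_cast
      linarith
  -- Playing `v` throughout loses nothing on `T` and at most two points, from `+1` to `-1`, on each
  -- other vertex of `S`.
  have hup : ∀ n, deficit D R (a n) ≤ 2 * S.card := by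
    intro n
    have h1 := sum_gain_le_value D R v _ (a n) rfl
    rw [← scoreAgainst_eq_value] at h1
    have h2 : ∑ u, ((a n u : ℝ) - a n u * gain D v u) ≤ ∑ u, if u ∈ S then (2 : ℝ) else 0 := by
      refine Finset.sum_le_sum fun u _ => ?_
      by_cases hu : u ∈ T
      · have hv : D.Adj v u := (Finset.mem_filter.1 hu).2
        rw [gain_of_adj D hv]
        split_ifs <;> simp
      · have hg : (-1 : ℝ) ≤ gain D v u := by exact_mod_cast neg_one_le_gain D v u
        by_cases hS : u ∈ S
        · simp only [a, hu, hS, if_true, if_false]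
          push_cast
          linarith
        · simp [a, hu, hS]
    rw [Finset.sum_sub_distrib] at h2
    have h3 : ∑ u, (if u ∈ S then (2 : ℝ) else 0) = 2 * S.card := by
      simp [Finset.sum_ite_mem, mul_comm]
    rw [deficit]
    linarith
  obtain ⟨n, hn⟩ := exists_nat_gt ((2 * S.card - deficit D R (a 0)) * T.card)
  have h1 := (hlow n).trans (hup n)
  have h2 : (n : ℝ) * (T.card : ℝ)⁻¹ * T.card = n := by
    rw [mul_assoc, inv_mul_cancel₀ hTcard.ne', mul_one]
  have h3 := mul_le_mul_of_nonneg_right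
    (show (n : ℝ) * (T.card : ℝ)⁻¹ ≤ 2 * S.card - deficit D R (a 0) by linarith) hTcard.le
  linarith

/-- For a law carried by an even set `S` of vertices of a tournament, the expected gains of the
vertices in `S` cannot all be equal. -/
theorem not_forall_expectedGain_eq (hD : IsTournament D) {S : Finset V} (hS : Even S.card)
    {q : V → ℝ} (hq1 : ∑ u, q u = 1) (hqS : ∀ u ∉ S, q u = 0) (M : ℝ) :
    ¬ ∀ v ∈ S, expectedGain D q v = M := by
  classical
  intro hM
  have hskew : ∑ v, q v * expectedGain D q v = 0 := by
    have h1 : ∑ v, q v * expectedGain D q v = ∑ v, ∑ u, q v * (q u * gain D v u) := by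
      simp only [expectedGain, Finset.mul_sum]
    have h2 : ∑ v, ∑ u, q v * (q u * gain D v u) = -∑ v, ∑ u, q v * (q u * (gain D v u : ℝ)) := by
      conv_lhs => rw [Finset.sum_comm]
      simp only [← Finset.sum_neg_distrib]
      refine Finset.sum_congr rfl fun v _ => Finset.sum_congr rfl fun u _ => ?_
      rw [gain_swap hD.1 v u]
      push_cast
      ring
    rw [h1]
    linarith
  have hM0 : M = 0 := by
    rw [← hskew, ← one_mul M, ← hq1, Finset.sum_mul]
    refine Finset.sum_congr rfl fun v _ => ?_
    by_cases hv : v ∈ S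
    · rw [hM v hv]
    · rw [hqS v hv, zero_mul, zero_mul]
  have hzero := Matrix.eq_zero_of_mulVec_eq_zero (det_gain_ne_zero hD S hS)
    (v := fun i : S => q i) (by
      funext i
      have h1 := hM i i.2
      rw [hM0, expectedGain, ← Finset.sum_subset (Finset.subset_univ S)
        (fun u _ hu => by rw [hqS u hu, zero_mul]), ← Finset.sum_coe_sort] at h1
      simpa [Matrix.mulVec, dotProduct, mul_comm] using h1)
  have : ∑ u, q u = 0 := Finset.sum_eq_zero fun u _ => by
    by_cases hu : u ∈ S
    · exact congrFun hzero ⟨u, hu⟩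
    · exact hqS u hu
  linarith

end Optimal

end SemiRestricted

end

/-! ### Conclusion. -/

theorem mainTheorem8 {V : Type*} [Fintype V] (D : Digraph V)
    (hD : SemiRestricted.IsTournament D) (S : Finset V) (hS : S.Nonempty) (hEven : Even S.card)
    (h : ∀ v ∈ S, ∀ w : V, w ≠ v →
      ¬ (SemiRestricted.outNbhd D v ∩ (S : Set V) ⊆ SemiRestricted.outNbhd D w ∩ (S : Set V))) :
    ¬ SemiRestricted.IsObliviousDigraph D := by
  classical
  rintro ⟨R, hR, hO⟩
  have : Nonempty V := ⟨hS.choose⟩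
  have hbeat : ∀ v ∈ S, ∀ w, w ≠ v → ∃ u ∈ S, D.Adj v u ∧ ¬ D.Adj w u := by
    intro v hv w hw
    obtain ⟨u, ⟨hvu, huS⟩, hn⟩ := Set.not_subset.1 (h v hv w hw)
    exact ⟨u, huS, hvu, fun hwu => hn ⟨hwu, huS⟩⟩
  -- A second vertex `w` is needed so that the hypothesis yields a vertex of `S` beaten by `v`.
  have hcard : 1 < S.card := by
    obtain ⟨k, hk⟩ := hEven
    have := hS.card_pos
    omega
  let r : SemiRestricted.RestrictionVector V := fun u => if u ∈ S then 1 else 0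
  have hr : Function.support r = S := by
    ext u
    simp [r]
  have hr0 : r ≠ 0 := by
    intro e
    have := hS.choose_spec
    rw [e, Function.support_zero] at hr
    exact (hr.symm ▸ this : hS.choose ∈ (∅ : Set V))
  refine SemiRestricted.not_forall_expectedGain_eq hD hEven
    (SemiRestricted.sum_weight (R.play r)) (fun u hu => ?_)
    (SemiRestricted.bestGain D (SemiRestricted.weight (R.play r))) fun v hv => ?_
  · refine SemiRestricted.weight_eq_zero fun hs => hu ?_
    have := R.support_subset r hr0 hs
    rwa [hr] at this
  · obtain ⟨w, -, hw⟩ := Finset.exists_mem_ne hcard v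
    obtain ⟨u, huS, hvu, -⟩ := hbeat v hv w hw
    exact hR.expectedGain_eq_bestGain hO ⟨u, huS, hvu⟩ (hbeat v hv) hr
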